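/- Let $n\ge 1$ and let $K$ be an ordered field (for instance $K=\mathbb{Q}$ or $K=\mathbb{R}$). Let $W=S_{n+1}$, the Weyl group of type $A_n$, with simple reflections $S=\{s_1,\dots,s_n\}$, $s_i=(i,\,i+1)$, act by permutation of coordinates on the span $V=\{x\in K^{n+1} : \sum_k x_k=0\}$ of the simple roots $e_i-e_{i+1}$. For a dominant weight $\lambda\in V$ (that is, $\lambda_1\ge\lambda_2\ge\dots\ge\lambda_{n+1}$) let $P_\lambda=\mathrm{Conv}(W\lambda)$, and say that $\lambda$ is of type $J=\{s\in S : s\lambda=\lambda\}$. A subset $J\subseteq S$ is called combinatorially smooth if weights of type $J$ exist and $P_\lambda$ is a simple polytope (each vertex lies on exactly $\dim P_\lambda$ edges) for all of them. The $h$-polynomial of the projective toric variety $X(J)$ associated with the normal fan of $P_\lambda$, for $\lambda$ of type $J$, is $h(t)=\sum_{i=0}^{d} f_i\,(t-1)^i$, where $d=\dim P_\lambda$ and $f_i$ is the number of $i$-dimensional faces of $P_\lambda$. Let $E_m(t)=\sum_i E(m,i)\,t^i$ be the $m$-th Eulerian polynomial, where $E(m,i)$ is the number of permutations in $S_m$ with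 exactly $i$ ascents ($E_0=1$). Let $J=\{s_n\}$. Then $J$ is combinatorially smooth, and for every dominant weight $\lambda$ of type $J$ the $h$-polynomial of $X(J)$ is $$h(t)=E_{n+1}(t)-\binom{n+1}{2}\,t\,E_{n-1}(t).$$ -/

import Mathlib

open Polynomial

/-! ### Faces, simple polytopes and `h`-polynomials over an ordered field -/

section Polytopes

variable (K : Type*) {V : Type*} [Field K] [LinearOrder K] [AddCommGroup V] [Module K V]

/-- `F` is a nonempty face of `P`: the set of all points of `P` at which some linear functional
attains its maximum over `P`. The zero functional gives `P` itself. -/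
def IsFace (P F : Set V) : Prop :=
  F.Nonempty ∧ ∃ l : Module.Dual K V, F = {x | x ∈ P ∧ ∀ y ∈ P, l y ≤ l x}

/-- The dimension of (the affine span of) a set. -/
noncomputable def affDim (F : Set V) : ℕ :=
  Module.finrank K (vectorSpan K F)

/-- `P` is a simple polytope: it is the convex hull of a finite set, and each of its vertices lies
on exactly `dim P` edges. -/
def IsSimplePolytope (P : Set V) : Prop :=
  (∃ s : Set V, s.Finite ∧ P = convexHull K s) ∧
    ∀ v : V, IsFace K P {v} →
      {F : Set V | IsFace K P F ∧ affDim K F = 1 ∧ v ∈ F}.encard = (affDim K P : ℕ∞)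

/-- The number `f_i` of `i`-dimensional faces of `P`. -/
noncomputable def faceNumber (P : Set V) (i : ℕ) : ℕ :=
  {F : Set V | IsFace K P F ∧ affDim K F = i}.ncard

/-- The `h`-polynomial `h(t) = ∑ f_i (t - 1)^i`, where `i` runs from `0` to `dim P`. -/
noncomputable def hPolynomial (P : Set V) : ℤ[X] :=
  ∑ i ∈ Finset.range (affDim K P + 1), (faceNumber K P i : ℤ[X]) * (X - 1) ^ i

end Polytopes

/-! ### Weights and weight polytopes in type `A_n`

The Weyl group of type `A_n` is the symmetric group of `{0, …, n}`, acting by permutation of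
coordinates on the space of vectors of coordinate sum zero, the span of the simple roots
`e_i - e_{i+1}`. -/

section TypeA

/-- The simple reflections: `simpleReflection n i` exchanges `i` and `i + 1` in `{0, …, n}`. In the
usual numbering, which starts from one, it is `s_{i+1} = (i+1, i+2)`. -/
def simpleReflection (n : ℕ) (i : Fin n) : Equiv.Perm (Fin (n + 1)) :=
  Equiv.swap i.castSucc i.succ

variable {K : Type*} [Field K] [LinearOrder K] {n : ℕ}

/-- The action of the Weyl group: `(σ w)_{σ(k)} = w_k`. -/
def weylAct (σ : Equiv.Perm (Fin (n + 1))) (w : Fin (n + 1) → K) : Fin (n + 1) → K :=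
  fun k => w (σ.symm k)

/-- The weight polytope `P_w = Conv(W · w)`. -/
def weightPolytope (w : Fin (n + 1) → K) : Set (Fin (n + 1) → K) :=
  convexHull K (Set.range fun σ : Equiv.Perm (Fin (n + 1)) => weylAct σ w)

/-- `w` is a dominant weight (it lies in the span of the simple roots and pairs non-negatively with
each simple coroot) and `J` is the set of simple reflections that fix `w`. -/
def IsDominantOfType (J : Set (Equiv.Perm (Fin (n + 1)))) (w : Fin (n + 1) → K) : Prop :=
  ∑ k, w k = 0 ∧ (∀ i : Fin n, w i.succ ≤ w i.castSucc) ∧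
    J = {s | s ∈ Set.range (simpleReflection n) ∧ weylAct s w = w}

variable (K) in
/-- `J` is combinatorially smooth: the weight polytope of a dominant weight of type `J` is a simple
polytope. There is such a weight, and the property is required of all of them. -/
def CombinatoriallySmooth (J : Set (Equiv.Perm (Fin (n + 1)))) : Prop :=
  (∃ w : Fin (n + 1) → K, IsDominantOfType J w) ∧
    ∀ w : Fin (n + 1) → K, IsDominantOfType J w → IsSimplePolytope K (weightPolytope w)

end TypeA

/-! ### Eulerian polynomials -/

/-- The number of ascents of a permutation `σ(0) σ(1) … σ(n-1)`. -/
def ascentCount {n : ℕ} (σ : Equiv.Perm (Fin n)) : ℕ :=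
  (Finset.univ.filter fun i : Fin n => ∃ h : i.val + 1 < n, σ i < σ ⟨i.val + 1, h⟩).card

/-- The Eulerian number `E(n, i)`: the number of permutations of `n` letters with `i` ascents. -/
def eulerianNumber (n i : ℕ) : ℕ :=
  (Finset.univ.filter fun σ : Equiv.Perm (Fin n) => ascentCount σ = i).card

/-- The Eulerian polynomial `E_n(t) = ∑ E(n, i) t^i`. The sum is over `i ≤ n`; for `n ≥ 1` the term
`i = n` is zero, and `E_0 = 1`. -/
noncomputable def eulerianPolynomial (n : ℕ) : ℤ[X] :=
  ∑ i ∈ Finset.range (n + 1), (eulerianNumber n i : ℤ[X]) * X ^ i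

/-! Reversing a dominant weight of type `{s_n}` gives a vector `u` with `u 0 = u 1 < u 2 < …`. By
the rearrangement inequality, a functional `c` is maximal on the orbit exactly at the `v` ordered
compatibly with `c`, so a face depends only on the ordered partition of the coordinates into level
sets of `c`. Encode it by a permutation `σ` sorting `c` and the set `A` of positions where `c ∘ σ`
does not jump; a stable sort gives `A ⊆ ascents σ`. Were the entries of `u` distinct, these pairs
would index the faces, with dimension `|A|`, and `∑ (t-1)^|A| = ∑ t^(asc σ)` would give `E_{n+1}`.

As `u 0 = u 1`, the partitions starting `{a},{b}` or `{b},{a}` or `{a,b}` give the same face; this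
is the case `1 ∉ A`, where `faceIndices` keeps only the pair with `0 ∈ ascents σ` and `0 ∉ A`.
Deleting the first two letters of `σ`, the discarded pairs contribute `((t-1) + 1) * choose (n+1) 2
* E_{n-1}`, from `σ 0 < σ 1` and `σ 0 > σ 1` respectively (`sum_faceIndices`). That `faceIndices`
indexes the faces by dimension is `IsDoubledMin.exists_mem_faceIndices`,
`IsDoubledMin.faceVertices_injOn` and `IsDoubledMin.affDim_faceVertices`.

For simplicity, the normal cone of a vertex is a union of two adjacent chambers, so its edges can be
listed (`IsDoubledMin.encard_edges`). -/

/-! ### Ascents and Eulerian polynomials -/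

section Ascents

open Finset Equiv

/-- The positions of the ascents of a permutation. -/
def ascents {N : ℕ} (σ : Perm (Fin N)) : Finset ℕ :=
  (range N).filter fun i => ∃ h : i + 1 < N, σ ⟨i, by omega⟩ < σ ⟨i + 1, h⟩

theorem mem_ascents {N : ℕ} {σ : Perm (Fin N)} {i : ℕ} :
    i ∈ ascents σ ↔ ∃ h : i + 1 < N, σ ⟨i, by omega⟩ < σ ⟨i + 1, h⟩ := by
  simp only [ascents, mem_filter, mem_range, and_iff_right_iff_imp]
  rintro ⟨h, -⟩
  omega

theorem card_ascents {N : ℕ} (σ : Perm (Fin N)) : (ascents σ).card = ascentCount σ := by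
  rw [ascentCount, ← card_map Fin.valEmbedding]
  congr 1
  ext i
  simp only [mem_ascents, mem_map, mem_filter, mem_univ, true_and, Fin.valEmbedding_apply]
  constructor
  · rintro ⟨h, hlt⟩
    exact ⟨⟨i, by omega⟩, ⟨h, hlt⟩, rfl⟩
  · rintro ⟨j, ⟨h, hlt⟩, rfl⟩
    exact ⟨h, hlt⟩

theorem eulerianPolynomial_eq_sum (N : ℕ) :
    eulerianPolynomial N = ∑ σ : Perm (Fin N), (X : ℤ[X]) ^ (ascents σ).card := by
  have hmaps : ∀ σ ∈ (univ : Finset (Perm (Fin N))), ascentCount σ ∈ range (N + 1) := by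
    intro σ _
    rw [mem_range, Nat.lt_succ_iff]
    exact (card_le_univ _).trans (by simp)
  rw [eulerianPolynomial, ← sum_fiberwise_of_maps_to hmaps]
  refine sum_congr rfl fun i _ => ?_
  rw [eulerianNumber, ← nsmul_eq_mul, ← sum_const]
  refine sum_congr rfl fun σ hσ => ?_
  rw [card_ascents, (mem_filter.1 hσ).2]

/-- The permutation with first letter `a` whose remaining letters are in the relative order
given by `τ`. -/
def consPerm {N : ℕ} (a : Fin (N + 1)) (τ : Perm (Fin N)) : Perm (Fin (N + 1)) :=
  (finSuccEquiv' 0).trans (τ.optionCongr.trans (finSuccEquiv' a).symm)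

@[simp] theorem consPerm_zero {N : ℕ} (a : Fin (N + 1)) (τ : Perm (Fin N)) :
    consPerm a τ 0 = a := by
  simp [consPerm]

@[simp] theorem consPerm_succ {N : ℕ} (a : Fin (N + 1)) (τ : Perm (Fin N)) (i : Fin N) :
    consPerm a τ i.succ = a.succAbove (τ i) := by
  have : finSuccEquiv' (0 : Fin (N + 1)) i.succ = some i := by
    rw [← Fin.zero_succAbove, finSuccEquiv'_succAbove]
  simp [consPerm, this]

theorem consPerm_bijective (N : ℕ) :
    Function.Bijective fun p : Fin (N + 1) × Perm (Fin N) => consPerm p.1 p.2 := by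
  rw [Fintype.bijective_iff_injective_and_card]
  constructor
  · rintro ⟨a, τ⟩ ⟨b, ρ⟩ h
    simp only at h
    have hab : a = b := by simpa using congrArg (fun σ : Perm (Fin (N + 1)) => σ 0) h
    subst hab
    refine Prod.ext rfl (Equiv.ext fun i => ?_)
    have := congrArg (fun σ : Perm (Fin (N + 1)) => σ i.succ) h
    simpa using this
  · simp [Fintype.card_perm, Nat.factorial_succ]

theorem succ_mem_ascents_consPerm {N : ℕ} (a : Fin (N + 1)) (τ : Perm (Fin N)) (i : ℕ) :
    i + 1 ∈ ascents (consPerm a τ) ↔ i ∈ ascents τ := by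
  simp only [mem_ascents]
  constructor
  · rintro ⟨h, hlt⟩
    refine ⟨by omega, ?_⟩
    have h1 := consPerm_succ a τ ⟨i, by omega⟩
    have h2 := consPerm_succ a τ ⟨i + 1, by omega⟩
    rw [Fin.succ_mk] at h1 h2
    rwa [h1, h2, Fin.succAbove_lt_succAbove_iff] at hlt
  · rintro ⟨h, hlt⟩
    refine ⟨by omega, ?_⟩
    have h1 := consPerm_succ a τ ⟨i, by omega⟩
    have h2 := consPerm_succ a τ ⟨i + 1, by omega⟩
    rw [Fin.succ_mk] at h1 h2
    rwa [h1, h2, Fin.succAbove_lt_succAbove_iff]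

theorem zero_mem_ascents_consPerm {N : ℕ} (a : Fin (N + 2)) (b : Fin (N + 1))
    (τ : Perm (Fin N)) :
    0 ∈ ascents (consPerm a (consPerm b τ)) ↔ a ≤ b.castSucc := by
  have h0 : consPerm a (consPerm b τ) ⟨0, by omega⟩ = a := consPerm_zero _ _
  have h1 : consPerm a (consPerm b τ) ⟨0 + 1, by omega⟩ = a.succAbove b := by
    have := consPerm_succ a (consPerm b τ) 0
    rw [consPerm_zero] at this
    exact this
  rw [mem_ascents]
  simp only [h0, h1, Fin.lt_succAbove_iff_le_castSucc]
  exact ⟨fun h => h.2, fun h => ⟨by omega, h⟩⟩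

/-- Position 1 is dropped too because it compares the second letter with the first letter of `τ`;
later ascents depend on `τ` alone. -/
theorem card_ascents_consPerm_consPerm {N : ℕ} (a : Fin (N + 2)) (b : Fin (N + 1))
    (τ : Perm (Fin N)) :
    ((ascents (consPerm a (consPerm b τ))) \ {0, 1}).card = (ascents τ).card := by
  rw [← card_map (s := ascents τ) (addRightEmbedding 2)]
  congr 1
  ext i
  simp only [mem_sdiff, mem_insert, mem_singleton, mem_map, addRightEmbedding_apply]
  constructor
  · rintro ⟨h, hi⟩
    obtain ⟨j, rfl⟩ : ∃ j, i = j + 1 + 1 := ⟨i - 2, by omega⟩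
    rw [succ_mem_ascents_consPerm, succ_mem_ascents_consPerm] at h
    exact ⟨j, h, rfl⟩
  · rintro ⟨j, h, rfl⟩
    refine ⟨?_, by omega⟩
    rw [show j + 2 = j + 1 + 1 from rfl, succ_mem_ascents_consPerm, succ_mem_ascents_consPerm]
    exact h

theorem card_filter_le_castSucc (N : ℕ) :
    ((univ : Finset (Fin (N + 2) × Fin (N + 1))).filter fun p => p.1 ≤ p.2.castSucc).card
      = (N + 2).choose 2 := by
  have h : ∀ b : Fin (N + 1), ((univ : Finset (Fin (N + 2))).filter
      fun a => a ≤ b.castSucc).card = (b : ℕ) + 1 := by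
    intro b
    rw [show (univ : Finset (Fin (N + 2))).filter (fun a => a ≤ b.castSucc) = Iic b.castSucc by
      ext; simp]
    simp
  rw [card_filter, Fintype.sum_prod_type_right]
  simp_rw [← card_filter, h]
  rw [Fin.sum_univ_eq_sum_range (fun b => b + 1) (N + 1), Finset.sum_add_distrib,
    Nat.choose_two_right, ← Finset.sum_range_id_mul_two (N + 2)]
  simp [Finset.sum_range_succ]

theorem card_filter_not_le_castSucc (N : ℕ) :
    ((univ : Finset (Fin (N + 2) × Fin (N + 1))).filter fun p => ¬ p.1 ≤ p.2.castSucc).card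
      = (N + 2).choose 2 := by
  have h := card_filter_add_card_filter_not (s := (univ : Finset (Fin (N + 2) × Fin (N + 1))))
    (fun p => p.1 ≤ p.2.castSucc)
  have h3 : (N + 2).choose 2 * 2 = (N + 2) * (N + 1) := by
    rw [Nat.choose_two_right, Nat.div_mul_cancel (Nat.even_mul_pred_self _).two_dvd]
    rfl
  rw [card_filter_le_castSucc, card_univ, Fintype.card_prod, Fintype.card_fin,
    Fintype.card_fin] at h
  omega

/-- The indices of the faces: a permutation together with a set of its ascents, subject to a
condition at the two smallest positions. -/
def faceIndices (m : ℕ) : Finset ((_ : Perm (Fin (m + 2))) × Finset ℕ) :=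
  univ.sigma fun σ => (ascents σ).powerset.filter fun A =>
    1 ∈ A ∨ (0 ∈ ascents σ ∧ 0 ∉ A)

theorem mem_faceIndices {m : ℕ} {σ : Perm (Fin (m + 2))} {A : Finset ℕ} :
    ⟨σ, A⟩ ∈ faceIndices m ↔ A ⊆ ascents σ ∧ (1 ∈ A ∨ (0 ∈ ascents σ ∧ 0 ∉ A)) := by
  simp [faceIndices]

theorem sum_powerset_pow {R : Type*} [CommRing R] (x : R) (D : Finset ℕ) :
    ∑ A ∈ D.powerset, (x - 1) ^ A.card = x ^ D.card := by
  have := sum_pow_mul_eq_add_pow (x - 1) 1 D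
  simpa using this

/-- The discarded sets omit 1 and contain 0 whenever 0 is available; the rest of the set is free in
`D \ {0, 1}`. A forced 0 costs the factor `x - 1`. -/
theorem sum_powerset_filter_not {R : Type*} [CommRing R] (x : R) (D : Finset ℕ) :
    ∑ A ∈ D.powerset with ¬ (1 ∈ A ∨ (0 ∈ D ∧ 0 ∉ A)), (x - 1) ^ A.card =
      (if 0 ∈ D then x - 1 else 1) * x ^ (D \ {0, 1}).card := by
  rw [← sum_powerset_pow, mul_sum]
  by_cases h0 : 0 ∈ D
  · simp only [h0, if_true, true_and]
    symm
    refine sum_bij (fun A _ => insert 0 A) ?_ ?_ ?_ ?_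
    · intro A hA
      grind
    · intro A hA B hB hAB
      have hA0 : 0 ∉ A := by grind
      have hB0 : 0 ∉ B := by grind
      rw [← erase_insert hA0, hAB, erase_insert hB0]
    · intro A hA
      refine ⟨A.erase 0, by grind, insert_erase (by grind)⟩
    · intro A hA
      rw [card_insert_of_notMem (by grind), pow_succ']
  · simp only [h0, if_false, false_and, or_false, one_mul]
    refine sum_congr ?_ fun _ _ => rfl
    ext A
    simp only [mem_filter, mem_powerset, subset_iff, mem_sdiff, mem_insert, mem_singleton]
    grind

theorem sum_perm_eq_sum_consPerm_consPerm {M : Type*} [AddCommMonoid M] (m : ℕ)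
    (f : Perm (Fin (m + 2)) → M) :
    ∑ σ, f σ = ∑ p : Fin (m + 2) × Fin (m + 1), ∑ τ : Perm (Fin m),
      f (consPerm p.1 (consPerm p.2 τ)) := by
  rw [← (consPerm_bijective (m + 1)).sum_comp, Fintype.sum_prod_type, Fintype.sum_prod_type]
  refine sum_congr rfl fun a _ => ?_
  rw [← (consPerm_bijective m).sum_comp, Fintype.sum_prod_type]

theorem sum_faceIndices (m : ℕ) :
    ∑ p ∈ faceIndices m, (X - 1 : ℤ[X]) ^ p.2.card =
      eulerianPolynomial (m + 2) - ((m + 2).choose 2 : ℤ[X]) * X * eulerianPolynomial m := by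
  have key : ∀ σ : Perm (Fin (m + 2)),
      ∑ A ∈ (ascents σ).powerset with (1 ∈ A ∨ (0 ∈ ascents σ ∧ 0 ∉ A)), (X - 1 : ℤ[X]) ^ A.card
      = X ^ (ascents σ).card -
        (if 0 ∈ ascents σ then X - 1 else 1) * X ^ (ascents σ \ {0, 1}).card := by
    intro σ
    rw [← sum_powerset_filter_not, ← sum_powerset_pow,
      ← sum_filter_add_sum_filter_not (ascents σ).powerset
        (fun A => 1 ∈ A ∨ (0 ∈ ascents σ ∧ 0 ∉ A))]
    ring
  rw [faceIndices, sum_sigma]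
  simp only [key]
  rw [sum_sub_distrib, ← eulerianPolynomial_eq_sum]
  congr 1
  rw [sum_perm_eq_sum_consPerm_consPerm]
  simp_rw [card_ascents_consPerm_consPerm, zero_mem_ascents_consPerm, ← mul_sum,
    ← eulerianPolynomial_eq_sum]
  rw [← sum_mul, sum_ite, sum_const, sum_const, card_filter_le_castSucc,
    card_filter_not_le_castSucc, nsmul_eq_mul, nsmul_eq_mul]
  ring

end Ascents

/-! ### Faces of the convex hull of a permutation orbit -/

section PermOrbit

open Finset Equiv

variable {K : Type*}

/-- The orbit of a vector under permutation of coordinates. -/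
def permOrbit {ι : Type*} (u : ι → K) : Set (ι → K) :=
  Set.range fun σ : Perm ι => u ∘ σ

theorem comp_mem_permOrbit {ι : Type*} {u v : ι → K} (hv : v ∈ permOrbit u) (σ : Perm ι) :
    v ∘ σ ∈ permOrbit u := by
  obtain ⟨ρ, rfl⟩ := hv
  exact ⟨ρ * σ, rfl⟩

theorem exists_eq_comp_of_mem_permOrbit {ι : Type*} {u v y : ι → K} (hv : v ∈ permOrbit u)
    (hy : y ∈ permOrbit u) : ∃ σ : Perm ι, y = v ∘ σ := by
  obtain ⟨ρ, rfl⟩ := hv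
  obtain ⟨τ, rfl⟩ := hy
  exact ⟨ρ⁻¹ * τ, by ext i; simp⟩

theorem permOrbit_finite {ι : Type*} [Finite ι] (u : ι → K) : (permOrbit u).Finite :=
  Set.finite_range _

variable [LinearOrder K]

/-- The points of the orbit of `u` that maximize the functional with coefficients `c`. -/
def orbitMaximizers {ι : Type*} (u c : ι → K) : Set (ι → K) :=
  {v | v ∈ permOrbit u ∧ Monovary v c}

theorem orbitMaximizers_nonempty {N : ℕ} (u c : Fin N → K) : (orbitMaximizers u c).Nonempty := by
  -- The sorted entries of `u` are placed along the coordinates in increasing order of `c`.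
  refine ⟨(u ∘ Tuple.sort u) ∘ (Tuple.sort c).symm, ⟨(Tuple.sort c).symm.trans (Tuple.sort u), rfl⟩, ?_⟩
  intro i j hij
  apply Tuple.monotone_sort u
  by_contra! h
  have := Tuple.monotone_sort c h.le
  simp only [Function.comp_apply, apply_symm_apply] at this
  exact absurd hij (not_lt.2 this)

variable [Field K]

theorem weightPolytope_eq_convexHull_permOrbit {n : ℕ} (w : Fin (n + 1) → K) :
    weightPolytope w = convexHull K (permOrbit (w ∘ Fin.rev)) := by
  rw [weightPolytope]
  congr 1
  ext v
  constructor
  · rintro ⟨σ, rfl⟩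
    refine ⟨σ.symm.trans Fin.revPerm, ?_⟩
    ext i
    simp [weylAct]
  · rintro ⟨σ, rfl⟩
    refine ⟨(σ.trans Fin.revPerm).symm, ?_⟩
    ext i
    simp [weylAct]

variable [IsStrictOrderedRing K]

theorem sum_mul_le_of_mem_orbitMaximizers {ι : Type*} [Fintype ι] {u c v y : ι → K}
    (hv : v ∈ orbitMaximizers u c) (hy : y ∈ permOrbit u) :
    ∑ i, y i * c i ≤ ∑ i, v i * c i := by
  obtain ⟨σ, rfl⟩ := exists_eq_comp_of_mem_permOrbit hv.1 hy
  exact hv.2.sum_comp_perm_mul_le_sum_mul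

theorem mem_orbitMaximizers_of_le {ι : Type*} [Fintype ι] {u c v y : ι → K}
    (hv : v ∈ orbitMaximizers u c) (hy : y ∈ permOrbit u)
    (h : ∑ i, v i * c i ≤ ∑ i, y i * c i) : y ∈ orbitMaximizers u c := by
  refine ⟨hy, ?_⟩
  obtain ⟨σ, rfl⟩ := exists_eq_comp_of_mem_permOrbit hv.1 hy
  exact hv.2.sum_comp_perm_mul_eq_sum_mul_iff.1 (le_antisymm hv.2.sum_comp_perm_mul_le_sum_mul h)

theorem le_of_mem_convexHull {V : Type*} [AddCommGroup V] [Module K V] {s : Set V}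
    {l : Module.Dual K V} {M : K} (hM : ∀ y ∈ s, l y ≤ M) {x : V} (hx : x ∈ convexHull K s) :
    l x ≤ M :=
  convexHull_min (t := {y | l y ≤ M}) hM (convex_halfSpace_le l.isLinear M) hx

/-- In a convex combination reaching the bound `M`, the nonnegative terms `a y * (M - l y)` sum to
zero, so only points attaining `M` carry weight. -/
theorem mem_convexHull_maximizers {V : Type*} [AddCommGroup V] [Module K V] {s : Set V}
    (hs : s.Finite) {l : Module.Dual K V} {M : K} (hM : ∀ y ∈ s, l y ≤ M) {x : V}
    (hx : x ∈ convexHull K s) (hlx : M ≤ l x) : x ∈ convexHull K {y | y ∈ s ∧ M ≤ l y} := by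
  lift s to Finset V using hs
  obtain ⟨a, ha0, ha1, rfl⟩ := Finset.mem_convexHull'.1 hx
  have hsum : ∑ y ∈ s, a y * (M - l y) = 0 := by
    refine le_antisymm ?_ (sum_nonneg fun y hy => mul_nonneg (ha0 y hy) (sub_nonneg.2 (hM y hy)))
    simp only [map_sum, map_smul, smul_eq_mul] at hlx
    simp only [mul_sub, sum_sub_distrib, ← sum_mul, ha1, one_mul]
    linarith
  have hzero := (sum_eq_zero_iff_of_nonneg
    fun y hy => mul_nonneg (ha0 y hy) (sub_nonneg.2 (hM y hy))).1 hsum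
  have hne : ∀ y ∈ s, a y ≠ 0 → M ≤ l y := fun y hy hay =>
    (sub_eq_zero.1 ((mul_eq_zero.1 (hzero y hy)).resolve_left hay)).le
  rw [← sum_filter_of_ne (p := fun y => M ≤ l y)
    fun y hy h => hne y hy fun h0 => h (by rw [h0, zero_smul])]
  rw [← sum_filter_of_ne (p := fun y => M ≤ l y) hne] at ha1
  refine (convex_convexHull K _).sum_mem (fun y hy => ha0 y (mem_filter.1 hy).1) ha1
    fun y hy => subset_convexHull K _ ?_
  simpa using hy

theorem maximal_points_eq_convexHull {N : ℕ} (u c : Fin N → K) {l : Module.Dual K (Fin N → K)}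
    (hl : ∀ x, l x = ∑ i, x i * c i) :
    {x | x ∈ convexHull K (permOrbit u) ∧ ∀ y ∈ convexHull K (permOrbit u), l y ≤ l x} =
      convexHull K (orbitMaximizers u c) := by
  obtain ⟨v, hv⟩ := orbitMaximizers_nonempty u c
  have hM : ∀ y ∈ permOrbit u, l y ≤ l v := fun y hy => by
    rw [hl, hl]
    exact sum_mul_le_of_mem_orbitMaximizers hv hy
  ext x
  constructor
  · rintro ⟨hx, hmax⟩
    refine convexHull_mono ?_ (mem_convexHull_maximizers (permOrbit_finite u) hM hx
      (hmax v (subset_convexHull K _ hv.1)))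
    rintro y ⟨hy, hly⟩
    rw [hl, hl] at hly
    exact mem_orbitMaximizers_of_le hv hy hly
  · intro hx
    refine ⟨convexHull_mono (fun y hy => hy.1) hx, fun y hy => ?_⟩
    have h1 : l y ≤ l v := le_of_mem_convexHull hM hy
    have h2 : (-l) x ≤ -l v := le_of_mem_convexHull (fun z hz => by
      rw [LinearMap.neg_apply, neg_le_neg_iff, hl, hl]
      exact sum_mul_le_of_mem_orbitMaximizers hz hv.1) hx
    rw [LinearMap.neg_apply, neg_le_neg_iff] at h2
    exact h1.trans h2

theorem isFace_convexHull_permOrbit_iff {N : ℕ} (u : Fin N → K) (F : Set (Fin N → K)) :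
    IsFace K (convexHull K (permOrbit u)) F ↔ ∃ c, F = convexHull K (orbitMaximizers u c) := by
  constructor
  · rintro ⟨-, l, rfl⟩
    exact ⟨fun i => l fun j => if i = j then 1 else 0, maximal_points_eq_convexHull u _
      fun x => by simpa using LinearMap.pi_apply_eq_sum_univ l x⟩
  · rintro ⟨c, rfl⟩
    refine ⟨(orbitMaximizers_nonempty u c).convexHull, ∑ i, c i • LinearMap.proj i, ?_⟩
    rw [maximal_points_eq_convexHull u c]
    intro x
    simp [mul_comm]

/-- A face determines its set of orbit points, so faces may be compared through finite sets. -/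
theorem permOrbit_inter_convexHull_orbitMaximizers {N : ℕ} (u c : Fin N → K) :
    permOrbit u ∩ convexHull K (orbitMaximizers u c) = orbitMaximizers u c := by
  refine Set.Subset.antisymm ?_ fun v hv => ⟨hv.1, subset_convexHull K _ hv⟩
  rintro y ⟨hy, hyc⟩
  obtain ⟨v, hv⟩ := orbitMaximizers_nonempty u c
  have hl : ∀ x, (∑ i, c i • LinearMap.proj i : Module.Dual K (Fin N → K)) x = ∑ i, x i * c i :=
    fun x => by simp [mul_comm]
  rw [← maximal_points_eq_convexHull u c hl] at hyc
  have := hyc.2 v (subset_convexHull K _ hv.1)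
  rw [hl, hl] at this
  exact mem_orbitMaximizers_of_le hv hy this

end PermOrbit

/-! ### Faces indexed by permutations and sets of positions -/

section FaceVertices

open Finset Equiv

variable {K : Type*} [LinearOrder K] {N : ℕ}

/-- The points `v` of the orbit of `u` such that, for `i ∉ A`, the entries of `v` at
`σ 0, …, σ i` are at most the remaining ones. -/
def faceVertices (u : Fin N → K) (σ : Perm (Fin N)) (A : Finset ℕ) : Set (Fin N → K) :=
  {v | v ∈ permOrbit u ∧ ∀ i ∉ A, ∀ j k : Fin N, j.val ≤ i → i < k.val → v (σ j) ≤ v (σ k)}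

theorem orbitMaximizers_eq_faceVertices (u : Fin N → K) {c : Fin N → K} {σ : Perm (Fin N)}
    {A : Finset ℕ} (hc : Monotone (c ∘ σ))
    (hA : ∀ i (h : i + 1 < N), i ∈ A ↔ c (σ ⟨i, by omega⟩) = c (σ ⟨i + 1, h⟩)) :
    orbitMaximizers u c = faceVertices u σ A := by
  ext v
  refine and_congr_right fun _ => ⟨fun h i hi j k hj hk => h ?_, fun h x y hxy => ?_⟩
  · have hiN : i + 1 < N := by omega
    have h1 : c (σ j) ≤ c (σ ⟨i, by omega⟩) := hc (show j ≤ ⟨i, by omega⟩ from hj)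
    have h2 : c (σ ⟨i + 1, hiN⟩) ≤ c (σ k) := hc (show ⟨i + 1, hiN⟩ ≤ k from hk)
    have h3 : c (σ ⟨i, by omega⟩) ≤ c (σ ⟨i + 1, hiN⟩) :=
      hc (show (⟨i, by omega⟩ : Fin N) ≤ ⟨i + 1, hiN⟩ from Nat.le_succ i)
    exact h1.trans_lt ((lt_of_le_of_ne h3 fun he => hi ((hA i hiN).2 he)).trans_le h2)
  · obtain ⟨j, rfl⟩ := σ.surjective x
    obtain ⟨k, rfl⟩ := σ.surjective y
    have hjk : j < k := by
      by_contra! hle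
      exact absurd hxy (not_lt.2 (hc hle))
    -- If every position between `j` and `k` were in `A`, then `c ∘ σ` would be constant from `j` to
    -- `k`.
    obtain ⟨i, hji, hik, hi⟩ : ∃ i, j.val ≤ i ∧ i < k.val ∧ i ∉ A := by
      by_contra! hall
      have : ∀ t, j.val ≤ t → ∀ ht : t < N, t ≤ k.val → c (σ j) = c (σ ⟨t, ht⟩) := by
        intro t hjt
        induction t, hjt using Nat.le_induction with
        | base => intro _ _; rfl
        | succ t hjt ih =>
          intro ht htk
          rw [ih (by omega) (by omega)]
          exact (hA t ht).1 (hall t hjt (by omega))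
      exact hxy.ne (this k hjk.le k.isLt le_rfl)
    exact h i hi j k hji hik

/-- The number of positions outside `A` that precede a letter. -/
def blockIndex (K : Type*) [Field K] (σ : Perm (Fin N)) (A : Finset ℕ) (x : Fin N) : K :=
  (((range (σ.symm x).val).filter fun i => i ∉ A).card : K)

variable [Field K] [IsStrictOrderedRing K]

/-- `blockIndex` jumps along `σ` exactly at the positions outside `A`, so every pair `(σ, A)` comes
from a functional. -/
theorem orbitMaximizers_blockIndex (u : Fin N → K) (σ : Perm (Fin N)) (A : Finset ℕ) :
    orbitMaximizers u (blockIndex K σ A) = faceVertices u σ A := by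
  apply orbitMaximizers_eq_faceVertices
  · intro i j hij
    simp only [Function.comp_apply, blockIndex, symm_apply_apply, Nat.cast_le]
    exact card_le_card (filter_subset_filter _ (range_subset_range.2 hij))
  · intro i h
    simp only [blockIndex, symm_apply_apply, Nat.cast_inj, range_add_one, filter_insert]
    by_cases hi : i ∈ A
    · simp [hi]
    · simp [hi]

theorem isFace_convexHull_faceVertices (u : Fin N → K) (σ : Perm (Fin N)) (A : Finset ℕ) :
    IsFace K (convexHull K (permOrbit u)) (convexHull K (faceVertices u σ A)) :=
  (isFace_convexHull_permOrbit_iff u _).2 ⟨_, by rw [orbitMaximizers_blockIndex]⟩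

theorem permOrbit_inter_convexHull_faceVertices (u : Fin N → K) (σ : Perm (Fin N))
    (A : Finset ℕ) :
    permOrbit u ∩ convexHull K (faceVertices u σ A) = faceVertices u σ A := by
  rw [← orbitMaximizers_blockIndex, permOrbit_inter_convexHull_orbitMaximizers]

theorem convexHull_faceVertices_inj {u : Fin N → K} {σ τ : Perm (Fin N)} {A B : Finset ℕ} :
    convexHull K (faceVertices u σ A) = convexHull K (faceVertices u τ B) ↔
      faceVertices u σ A = faceVertices u τ B := by
  refine ⟨fun h => ?_, fun h => by rw [h]⟩
  rw [← permOrbit_inter_convexHull_faceVertices, h, permOrbit_inter_convexHull_faceVertices]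

end FaceVertices

/-! ### Vectors whose two smallest entries agree and whose other entries are distinct -/

section DoubledMin

open Finset Equiv

variable {K : Type*} [LinearOrder K] {m : ℕ}

/-- The entries of `u` are in increasing order, and only the first two of them are equal. -/
def IsDoubledMin (u : Fin (m + 2) → K) : Prop :=
  ∀ i j, u i < u j ↔ i < j ∧ 1 < j.val

variable {u : Fin (m + 2) → K} {σ τ : Perm (Fin (m + 2))} {A B : Finset ℕ}

theorem IsDoubledMin.monotone (hu : IsDoubledMin u) : Monotone u := by
  intro i j hij
  by_contra! h
  exact absurd ((hu _ _).1 h).1 (not_lt.2 hij)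

theorem IsDoubledMin.comp_symm_mem_faceVertices (hu : IsDoubledMin u)
    (σ : Perm (Fin (m + 2))) (A : Finset ℕ) : u ∘ σ.symm ∈ faceVertices u σ A := by
  refine ⟨⟨σ.symm, rfl⟩, fun i _ j k hj hk => ?_⟩
  simp only [Function.comp_apply, symm_apply_apply]
  exact hu.monotone (show j.val ≤ k.val by omega)

/-- The entries at `σ 0` and `σ 1` are bounded by all others, so they are the two copies of the
minimum. -/
theorem IsDoubledMin.eq_of_forall_le (hu : IsDoubledMin u) {v : Fin (m + 2) → K}
    (hv : v ∈ permOrbit u) (h0 : ∀ k : Fin (m + 2), 1 < k.val → v (σ 0) ≤ v (σ k))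
    (h1 : ∀ k : Fin (m + 2), 1 < k.val → v (σ 1) ≤ v (σ k)) : v (σ 0) = v (σ 1) := by
  have key : ∀ (ρ : Perm (Fin (m + 2))) (a b : Fin (m + 2)), a ≠ b →
      (∀ k, k ≠ a → k ≠ b → u (ρ a) ≤ u (ρ k)) → u (ρ a) ≤ u (ρ b) := by
    intro ρ a b hab h
    by_contra! hlt
    obtain ⟨-, ha⟩ := (hu _ _).1 hlt
    -- If the entry at `a` is not minimal, both copies of the minimum must sit at the single place
    -- `b`.
    have hx : ∀ x : Fin (m + 2), x.val ≤ 1 → ρ.symm x = b := by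
      intro x hx
      by_contra hxb
      have hxa : ρ.symm x ≠ a := by
        rintro rfl
        rw [apply_symm_apply] at ha
        omega
      have hle := h _ hxa hxb
      rw [apply_symm_apply] at hle
      exact absurd ((hu x (ρ a)).2 ⟨by rw [Fin.lt_def]; omega, ha⟩) (not_lt.2 hle)
    simpa using (hx 0 (by simp)).trans (hx 1 (by simp)).symm
  obtain ⟨ρ, rfl⟩ := hv
  have hk : ∀ k : Fin (m + 2), k ≠ 0 → k ≠ 1 → 1 < k.val := by
    intro k hk0 hk1
    rw [Ne, Fin.ext_iff, Fin.val_zero] at hk0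
    rw [Ne, Fin.ext_iff, Fin.val_one] at hk1
    omega
  refine le_antisymm ?_ ?_
  · exact key (ρ * σ) 0 1 (by simp) fun k hk0 hk1 => h0 k (hk k hk0 hk1)
  · exact key (ρ * σ) 1 0 (by simp) fun k hk1 hk0 => h1 k (hk k hk0 hk1)

theorem IsDoubledMin.eq_of_mem_faceVertices (hu : IsDoubledMin u) {v : Fin (m + 2) → K}
    (hv : v ∈ faceVertices u σ A) (h1 : 1 ∉ A) : v (σ 0) = v (σ 1) :=
  hu.eq_of_forall_le hv.1 (fun k hk => hv.2 1 h1 0 k (by simp) hk)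
    fun k hk => hv.2 1 h1 1 k (by simp) hk

/-- When `1 ∉ A`, the entries at `σ 0` and `σ 1` agree on the whole face, so a break between them
imposes nothing. -/
theorem IsDoubledMin.faceVertices_erase_zero (hu : IsDoubledMin u) (h1 : 1 ∉ A) :
    faceVertices u σ (A.erase 0) = faceVertices u σ A := by
  refine Set.Subset.antisymm
    (fun v hv => ⟨hv.1, fun i hi => hv.2 i fun h => hi (mem_of_mem_erase h)⟩) fun v hv => ?_
  refine ⟨hv.1, fun i hi j k hj hk => ?_⟩
  rcases Nat.eq_zero_or_pos i with rfl | hi0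
  · obtain rfl : j = 0 := Fin.ext (by simpa using hj)
    by_cases hk1 : 1 < k.val
    · exact hv.2 1 h1 0 k (by simp) hk1
    · obtain rfl : k = 1 := Fin.ext (by simp; omega)
      exact (hu.eq_of_mem_faceVertices hv h1).le
  · exact hv.2 i (fun h => hi (mem_erase.2 ⟨hi0.ne', h⟩)) j k hj hk

theorem val_swap_zero_one_le {i : ℕ} (hi : 0 < i) {j : Fin (m + 2)} (hj : j.val ≤ i) :
    (swap (0 : Fin (m + 2)) 1 j).val ≤ i := by
  rw [swap_apply_def]
  split_ifs
  · rw [Fin.val_one]; omega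
  · rw [Fin.val_zero]; omega
  · exact hj

theorem lt_val_swap_zero_one {i : ℕ} (hi : 0 < i) {j : Fin (m + 2)} (hj : i < j.val) :
    i < (swap (0 : Fin (m + 2)) 1 j).val := by
  rw [swap_apply_of_ne_of_ne]
  · exact hj
  · rintro rfl; simp at hj
  · rintro rfl; simp at hj; omega

theorem IsDoubledMin.faceVertices_mul_swap (hu : IsDoubledMin u) (h0 : 0 ∉ A) (h1 : 1 ∉ A) :
    faceVertices u (σ * swap 0 1) A = faceVertices u σ A := by
  have key : ∀ σ : Perm (Fin (m + 2)),
      faceVertices u σ A ⊆ faceVertices u (σ * swap 0 1) A := by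
    intro σ v hv
    refine ⟨hv.1, fun i hi j k hj hk => ?_⟩
    simp only [Perm.mul_apply]
    rcases Nat.eq_zero_or_pos i with rfl | hi0
    · obtain rfl : j = 0 := Fin.ext (by simpa using hj)
      rw [swap_apply_left, ← hu.eq_of_mem_faceVertices hv h1]
      by_cases hk0 : swap 0 1 k = 0
      · rw [hk0]
      · exact hv.2 0 h0 0 _ (by simp) (Fin.pos_iff_ne_zero.2 hk0)
    · exact hv.2 i hi _ _ (val_swap_zero_one_le hi0 hj) (lt_val_swap_zero_one hi0 hk)
  refine Set.Subset.antisymm ?_ (key σ)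
  have := key (σ * swap 0 1)
  rwa [mul_assoc, swap_mul_self, mul_one] at this

/-! ### Recovering the index from the face -/

/-- No break separates `i` from `j`, so each prefix that imposes a condition contains both or
neither. -/
theorem comp_swap_mem_faceVertices {v : Fin (m + 2) → K} (hv : v ∈ faceVertices u σ A)
    {i j : Fin (m + 2)} (hij : ∀ k, i.val ≤ k → k < j.val → k ∈ A) (hlt : i < j) :
    v ∘ swap (σ i) (σ j) ∈ faceVertices u σ A := by
  refine ⟨comp_mem_permOrbit hv.1 _, fun k hk p q hp hq => ?_⟩
  have hk' : i.val ≤ k → j.val ≤ k := fun h => by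
    by_contra! h'
    exact hk (hij k h h')
  have hlt' : i.val < j.val := hlt
  simp only [Function.comp_apply, σ.injective.swap_apply]
  refine hv.2 k hk _ _ ?_ ?_
  · rw [swap_apply_def]
    split_ifs with h1 h2
    · subst h1; exact hk' hp
    · subst h2; omega
    · exact hp
  · rw [swap_apply_def]
    split_ifs with h1 h2
    · subst h1; omega
    · subst h2
      by_contra! h
      exact absurd hq (not_lt.2 (hk' h))
    · exact hq

theorem IsDoubledMin.exists_lt_of_one_lt (hu : IsDoubledMin u) (A : Finset ℕ)
    {i j : Fin (m + 2)} (hij : i < j) (hj : 1 < j.val) :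
    ∃ v ∈ faceVertices u σ A, v (σ i) < v (σ j) :=
  ⟨_, hu.comp_symm_mem_faceVertices σ A, by simpa using (hu i j).2 ⟨hij, hj⟩⟩

theorem IsDoubledMin.exists_lt_of_one_mem (hu : IsDoubledMin u) (h1 : 1 ∈ A)
    (hA : ∀ i ∈ A, i + 1 < m + 2) {i j : Fin (m + 2)} (hij : i < j) :
    ∃ v ∈ faceVertices u σ A, v (σ i) < v (σ j) := by
  by_cases hj : 1 < j.val
  · exact hu.exists_lt_of_one_lt A hij hj
  · have h2 := hA 1 h1
    rw [Fin.lt_def] at hij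
    obtain rfl : i = 0 := Fin.ext (by rw [Fin.val_zero]; omega)
    obtain rfl : j = 1 := Fin.ext (by rw [Fin.val_one]; omega)
    set k : Fin (m + 2) := ⟨2, h2⟩
    have hk : (1 : Fin (m + 2)) < k := by simp [Fin.lt_def, k]
    -- The base vertex has equal entries at `σ 0` and `σ 1`; since `1 ∈ A`, the larger entry `u 2`
    -- can be moved to `σ 1`.
    refine ⟨_, comp_swap_mem_faceVertices (hu.comp_symm_mem_faceVertices σ A) (i := 1) (j := k)
      (fun t ht htk => ?_) hk, ?_⟩
    · obtain rfl : t = 1 := by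
        simp only [Fin.val_one, k] at ht htk
        omega
      exact h1
    · simp only [Function.comp_apply, σ.injective.swap_apply, symm_apply_apply, swap_apply_left]
      rw [swap_apply_of_ne_of_ne (by simp) (by simp [Fin.ext_iff, k])]
      exact (hu _ _).2 ⟨lt_trans (by simp) hk, by simp [k]⟩

theorem IsDoubledMin.exists_lt (hu : IsDoubledMin u) (h01 : 0 ∈ A → 1 ∈ A)
    (hA : ∀ i ∈ A, i + 1 < m + 2) {i j : Fin (m + 2)} (hij : i < j)
    (hmem : ∀ k, i.val ≤ k → k < j.val → k ∈ A) :
    ∃ v ∈ faceVertices u σ A, v (σ i) < v (σ j) := by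
  by_cases hj : 1 < j.val
  · exact hu.exists_lt_of_one_lt A hij hj
  · rw [Fin.lt_def] at hij
    exact hu.exists_lt_of_one_mem (h01 (hmem 0 (by omega) (by omega))) hA hij

theorem IsDoubledMin.exists_gt (hu : IsDoubledMin u) (h01 : 0 ∈ A → 1 ∈ A)
    (hA : ∀ i ∈ A, i + 1 < m + 2) {i j : Fin (m + 2)} (hij : i < j)
    (hmem : ∀ k, i.val ≤ k → k < j.val → k ∈ A) :
    ∃ v ∈ faceVertices u σ A, v (σ j) < v (σ i) := by
  obtain ⟨v, hv, hlt⟩ := hu.exists_lt (σ := σ) h01 hA hij hmem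
  exact ⟨_, comp_swap_mem_faceVertices hv hmem hij, by simpa using hlt⟩

/-- The order on coordinates determined by a set of vectors: `x` precedes `y` if the entry at `x`
is always at most that at `y`, and ties are broken by the order of the coordinates. -/
def Precedes (T : Set (Fin (m + 2) → K)) (x y : Fin (m + 2)) : Prop :=
  ((∀ v ∈ T, v x ≤ v y) ∧ ¬ ∀ v ∈ T, v y ≤ v x) ∨
    (((∀ v ∈ T, v x ≤ v y) ↔ ∀ v ∈ T, v y ≤ v x) ∧ x < y)

theorem Precedes.not_symm {T : Set (Fin (m + 2) → K)} {x y : Fin (m + 2)}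
    (h : Precedes T x y) : ¬ Precedes T y x := by
  rintro (h' | h') <;> rcases h with h | h
  · exact h.2 h'.1
  · exact h'.2 (h.1.2 h'.1)
  · exact h.2 (h'.1.2 h.1)
  · exact lt_asymm h.2 h'.2

theorem add_one_lt_of_mem_ascents {N i : ℕ} {σ : Perm (Fin N)} (h : i ∈ ascents σ) : i + 1 < N :=
  (mem_ascents.1 h).1

theorem apply_lt_apply_of_subset_ascents {N : ℕ} {σ : Perm (Fin N)} {i j : Fin N} (hij : i < j)
    (h : ∀ k, i.val ≤ k → k < j.val → k ∈ ascents σ) : σ i < σ j := by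
  have : ∀ t, i.val + 1 ≤ t → ∀ ht : t < N, t ≤ j.val → σ i < σ ⟨t, ht⟩ := by
    intro t hit
    induction t, hit using Nat.le_induction with
    | base =>
      intro ht htj
      exact (mem_ascents.1 (h i.val le_rfl htj)).2
    | succ t hit ih =>
      intro ht htj
      exact (ih (by omega) (by omega)).trans (mem_ascents.1 (h t (by omega) (by omega))).2
  exact this j.val hij j.isLt le_rfl

/-- Coordinates in one block are not ordered by the face, but `A ⊆ ascents σ` makes `σ` increasing
there, so the tie-break recovers `σ`. -/
theorem IsDoubledMin.precedes (hu : IsDoubledMin u) (h : ⟨σ, A⟩ ∈ faceIndices m)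
    {i j : Fin (m + 2)} (hij : i < j) : Precedes (faceVertices u σ A) (σ i) (σ j) := by
  rw [mem_faceIndices] at h
  obtain ⟨hA, h01⟩ := h
  have hA' : ∀ i ∈ A, i + 1 < m + 2 := fun i hi => add_one_lt_of_mem_ascents (hA hi)
  by_cases hmem : ∀ k, i.val ≤ k → k < j.val → k ∈ A
  · obtain ⟨v, hv, hvlt⟩ := hu.exists_lt (σ := σ) (by tauto) hA' hij hmem
    obtain ⟨w, hw, hwlt⟩ := hu.exists_gt (σ := σ) (by tauto) hA' hij hmem
    refine Or.inr ⟨iff_of_false ?_ ?_, apply_lt_apply_of_subset_ascents hij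
      fun k h1 h2 => hA (hmem k h1 h2)⟩
    · exact fun h => absurd hwlt (not_lt.2 (h w hw))
    · exact fun h => absurd hvlt (not_lt.2 (h v hv))
  · push Not at hmem
    obtain ⟨k, hik, hkj, hk⟩ := hmem
    have hle : ∀ v ∈ faceVertices u σ A, v (σ i) ≤ v (σ j) := fun v hv => hv.2 k hk i j hik hkj
    by_cases hge : ∀ v ∈ faceVertices u σ A, v (σ j) ≤ v (σ i)
    -- Entries equal throughout the face occur only at `σ 0, σ 1` with `1 ∉ A`; then membership in
    -- `faceIndices` forces `0 ∈ ascents σ`.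
    · refine Or.inr ⟨iff_of_true hle hge, ?_⟩
      have hj : ¬ 1 < j.val := fun hj => by
        obtain ⟨v, hv, hlt⟩ := hu.exists_lt_of_one_lt (σ := σ) A hij hj
        exact absurd hlt (not_lt.2 (hge v hv))
      have h1 : 1 ∉ A := fun h1 => by
        obtain ⟨v, hv, hlt⟩ := hu.exists_lt_of_one_mem (σ := σ) h1 hA' hij
        exact absurd hlt (not_lt.2 (hge v hv))
      refine apply_lt_apply_of_subset_ascents hij fun k _ _ => ?_
      obtain rfl : k = 0 := by omega
      tauto
    · exact Or.inl ⟨hle, hge⟩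

theorem IsDoubledMin.lt_iff_precedes (hu : IsDoubledMin u) (h : ⟨σ, A⟩ ∈ faceIndices m)
    {i j : Fin (m + 2)} : i < j ↔ Precedes (faceVertices u σ A) (σ i) (σ j) := by
  refine ⟨hu.precedes h, fun hp => ?_⟩
  rcases lt_trichotomy i j with hij | rfl | hij
  · exact hij
  · exact absurd hp hp.not_symm
  · exact absurd (hu.precedes h hij) hp.not_symm

theorem IsDoubledMin.mem_iff (hu : IsDoubledMin u) (h : ⟨σ, A⟩ ∈ faceIndices m) {i : ℕ} :
    i ∈ A ↔ ∃ hi : i + 1 < m + 2,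
      ∃ v ∈ faceVertices u σ A, v (σ ⟨i + 1, hi⟩) < v (σ ⟨i, by omega⟩) := by
  rw [mem_faceIndices] at h
  obtain ⟨hA, h01⟩ := h
  have hA' : ∀ i ∈ A, i + 1 < m + 2 := fun i hi => add_one_lt_of_mem_ascents (hA hi)
  refine ⟨fun hi => ⟨hA' i hi, hu.exists_gt (by tauto) hA'
    (by simp [Fin.lt_def]) fun k hk hk' => ?_⟩, ?_⟩
  · obtain rfl : k = i := by
      simp only at hk hk'
      omega
    exact hi
  · rintro ⟨hi, v, hv, hlt⟩
    by_contra hiA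
    exact absurd hlt (not_lt.2 (hv.2 i hiA _ _ le_rfl (Nat.lt_succ_self i)))

theorem IsDoubledMin.faceVertices_injOn (hu : IsDoubledMin u) :
    Set.InjOn (fun p : (_ : Perm (Fin (m + 2))) × Finset ℕ => faceVertices u p.1 p.2)
      (faceIndices m) := by
  rintro ⟨σ, A⟩ hσ ⟨τ, B⟩ hτ h
  simp only at h
  have hmono : StrictMono (τ.symm ∘ σ) := by
    intro i j hij
    have := (hu.lt_iff_precedes hσ).1 hij
    rw [h] at this
    rw [hu.lt_iff_precedes hτ]
    simpa using this
  -- A strictly increasing surjection of `Fin (m + 2)` onto itself is the identity.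
  have hid : τ.symm ∘ σ = id := (StrictMono.range_inj hmono strictMono_id).1 (by
    rw [Set.range_id, Set.range_eq_univ]
    exact τ.symm.surjective.comp σ.surjective)
  obtain rfl : σ = τ := Equiv.ext fun i => by
    have := congrFun hid i
    simpa [symm_apply_eq] using this
  obtain rfl : A = B := by
    ext i
    rw [hu.mem_iff hσ, hu.mem_iff hτ]
    simp only [h]
  rfl

/-! ### Every face has an index -/

theorem exists_orbitMaximizers_eq_faceVertices (u : Fin (m + 2) → K) {c : Fin (m + 2) → K}
    (hc : Monotone (c ∘ σ)) :
    ∃ A : Finset ℕ, (∀ i, i ∈ A ↔ ∃ h : i + 1 < m + 2, c (σ ⟨i, by omega⟩) = c (σ ⟨i + 1, h⟩)) ∧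
      orbitMaximizers u c = faceVertices u σ A := by
  classical
  have hmem : ∀ i, i ∈ (range (m + 2)).filter
      (fun i => ∃ h : i + 1 < m + 2, c (σ ⟨i, by omega⟩) = c (σ ⟨i + 1, h⟩)) ↔
      ∃ h : i + 1 < m + 2, c (σ ⟨i, by omega⟩) = c (σ ⟨i + 1, h⟩) := by
    intro i
    rw [mem_filter, mem_range, and_iff_right_iff_imp]
    rintro ⟨h, -⟩
    omega
  refine ⟨_, hmem, orbitMaximizers_eq_faceVertices u hc fun i h => ?_⟩
  rw [hmem]
  exact ⟨fun ⟨_, h⟩ => h, fun h' => ⟨h, h'⟩⟩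

theorem succ_succ_mem_ascents_mul_swap {i : ℕ} :
    i + 2 ∈ ascents (σ * swap 0 1) ↔ i + 2 ∈ ascents σ := by
  simp only [mem_ascents, Perm.mul_apply]
  refine exists_congr fun h => ?_
  rw [swap_apply_of_ne_of_ne (by simp [Fin.ext_iff]) (by simp [Fin.ext_iff]),
    swap_apply_of_ne_of_ne (by simp [Fin.ext_iff]) (by simp [Fin.ext_iff])]

theorem zero_mem_ascents_mul_swap : 0 ∈ ascents (σ * swap 0 1) ↔ 0 ∉ ascents σ := by
  have h0 : (⟨0, by omega⟩ : Fin (m + 2)) = 0 := rfl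
  have h1 : (⟨0 + 1, by omega⟩ : Fin (m + 2)) = 1 := rfl
  simp only [mem_ascents, Perm.mul_apply, h0, h1, swap_apply_left, swap_apply_right]
  have : σ 1 ≠ σ 0 := fun h => by simpa using σ.injective h
  constructor
  · rintro ⟨_, h⟩ ⟨_, h'⟩
    exact lt_asymm h h'
  · intro h
    refine ⟨by omega, lt_of_le_of_ne (not_lt.1 fun h' => h ⟨by omega, h'⟩) this⟩

theorem IsDoubledMin.exists_mem_faceIndices (hu : IsDoubledMin u) (c : Fin (m + 2) → K) :
    ∃ p ∈ faceIndices m, orbitMaximizers u c = faceVertices u p.1 p.2 := by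
  obtain ⟨A, hA, hcA⟩ := exists_orbitMaximizers_eq_faceVertices u (Tuple.monotone_sort c)
  -- The sort is stable: equal values of `c` are listed in increasing order of coordinate, hence at
  -- ascents.
  have hsort := ((Tuple.eq_sort_iff (f := c)).1 rfl).2
  have hasc : A ⊆ ascents (Tuple.sort c) := by
    intro i hi
    obtain ⟨h, he⟩ := (hA i).1 hi
    exact mem_ascents.2 ⟨h, hsort _ _ (by simp [Fin.lt_def]) he⟩
  by_cases h1 : 1 ∈ A
  · exact ⟨⟨_, A⟩, mem_faceIndices.2 ⟨hasc, Or.inl h1⟩, hcA⟩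
  by_cases h0 : 0 ∈ ascents (Tuple.sort c)
  · refine ⟨⟨_, A.erase 0⟩, mem_faceIndices.2 ⟨(erase_subset _ _).trans hasc,
      Or.inr ⟨h0, notMem_erase _ _⟩⟩, ?_⟩
    rw [hcA, hu.faceVertices_erase_zero h1]
  · have h0A : 0 ∉ A := fun h => h0 (hasc h)
    refine ⟨⟨Tuple.sort c * swap 0 1, A⟩, mem_faceIndices.2 ⟨fun i hi => ?_,
      Or.inr ⟨zero_mem_ascents_mul_swap.2 h0, h0A⟩⟩, ?_⟩
    · obtain ⟨i, rfl⟩ : ∃ t, i = t + 2 := ⟨i - 2, by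
        have : i ≠ 0 := by rintro rfl; exact h0A hi
        have : i ≠ 1 := by rintro rfl; exact h1 hi
        omega⟩
      exact succ_succ_mem_ascents_mul_swap.2 (hasc hi)
    · rw [hcA, hu.faceVertices_mul_swap h0A h1]

end DoubledMin

/-! ### Dimensions of the faces -/

section Dimension

open Finset Equiv

variable {K : Type*} [Field K] {N : ℕ}

/-- The sum of the entries at `σ 0, …, σ k`. -/
def prefixSum (K : Type*) [Field K] (σ : Perm (Fin N)) (k : ℕ) : Module.Dual K (Fin N → K) :=
  ∑ j with j.val ≤ k, LinearMap.proj (σ j)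

theorem prefixSum_apply (σ : Perm (Fin N)) (k : ℕ) (x : Fin N → K) :
    prefixSum K σ k x = ∑ j with j.val ≤ k, x (σ j) := by
  simp [prefixSum]

/-- The entries are successive differences of prefix sums. With `prefixSum_permRoot`, this makes
prefix sums coordinates dual to the roots. -/
theorem eq_of_prefixSum_eq {σ : Perm (Fin N)} {x y : Fin N → K}
    (h : ∀ k, prefixSum K σ k x = prefixSum K σ k y) : x = y := by
  have hzero : ∀ (z : Fin N → K) (h0 : 0 < N), prefixSum K σ 0 z = z (σ ⟨0, h0⟩) := by
    intro z h0
    rw [prefixSum_apply, show (univ.filter fun j : Fin N => j.val ≤ 0) = {⟨0, h0⟩} by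
      ext j; simp [Fin.ext_iff], sum_singleton]
  have hsucc : ∀ (z : Fin N → K) (k : ℕ) (hk : k + 1 < N),
      prefixSum K σ (k + 1) z = z (σ ⟨k + 1, hk⟩) + prefixSum K σ k z := by
    intro z k hk
    rw [prefixSum_apply, prefixSum_apply, show (univ.filter fun j : Fin N => j.val ≤ k + 1) =
      insert ⟨k + 1, hk⟩ (univ.filter fun j : Fin N => j.val ≤ k) by
        ext j; simp [Fin.ext_iff]; omega, sum_insert (by simp)]
  ext t
  obtain ⟨⟨k, hk⟩, rfl⟩ := σ.surjective t
  cases k with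
  | zero => rw [← hzero x hk, ← hzero y hk, h]
  | succ k =>
    have hx := hsucc x k hk
    rw [h, hsucc y k hk, h k] at hx
    exact (add_right_cancel hx).symm

/-- The difference of the basis vectors at `σ i` and `σ (i + 1)`. -/
def permRoot (K : Type*) [Field K] (σ : Perm (Fin N)) (i : ℕ) : Fin N → K := fun x =>
  (if (σ.symm x).val = i then 1 else 0) - if (σ.symm x).val = i + 1 then 1 else 0

theorem prefixSum_permRoot (σ : Perm (Fin N)) {i : ℕ} (hi : i + 1 < N) (k : ℕ) :
    prefixSum K σ k (permRoot K σ i) = if i = k then 1 else 0 := by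
  have h : ∀ t < N, (∑ j : Fin N with j.val ≤ k, (if j.val = t then 1 else 0 : K)) =
      if t ≤ k then 1 else 0 := by
    intro t ht
    have : ∀ j : Fin N, j.val = t ↔ j = ⟨t, ht⟩ := fun j => by rw [Fin.ext_iff]
    simp_rw [this, sum_ite_eq', mem_filter, mem_univ, true_and]
  simp only [prefixSum_apply, permRoot, symm_apply_apply]
  rw [sum_sub_distrib, h _ (by omega), h _ hi]
  split_ifs <;> first | omega | simp

theorem linearIndependent_permRoot (σ : Perm (Fin N)) {A : Finset ℕ}
    (hA : ∀ i ∈ A, i + 1 < N) : LinearIndependent K fun i : A => permRoot K σ i := by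
  refine LinearIndependent.of_pairwise_dual_eq_zero_one _ (fun i : A => prefixSum K σ i) ?_ ?_
  · intro i j hij
    rw [prefixSum_permRoot σ (hA j j.2), if_neg fun h => hij (Subtype.ext h.symm)]
  · intro i
    rw [prefixSum_permRoot σ (hA i i.2), if_pos rfl]

variable [LinearOrder K]

theorem affDim_convexHull {V : Type*} [AddCommGroup V] [Module K V] (s : Set V) :
    affDim K (convexHull K s) = affDim K s := by
  rw [affDim, affDim, ← direction_affineSpan, affineSpan_convexHull, direction_affineSpan]

/-- Exchanging two unequal neighbouring entries of a block moves along a root. If `0 ∈ A` and `1 ∉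
A`, the entries at `σ 0, σ 1` never differ, hence `h01`. -/
theorem IsDoubledMin.permRoot_mem_vectorSpan {m : ℕ} {u : Fin (m + 2) → K}
    (hu : IsDoubledMin u) (σ : Perm (Fin (m + 2))) {A : Finset ℕ} (hA : ∀ i ∈ A, i + 1 < m + 2)
    (h01 : 0 ∈ A → 1 ∈ A) {i : ℕ} (hi : i ∈ A) :
    permRoot K σ i ∈ vectorSpan K (faceVertices u σ A) := by
  set a : Fin (m + 2) := ⟨i, by have := hA i hi; omega⟩ with ha
  set b : Fin (m + 2) := ⟨i + 1, hA i hi⟩ with hb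
  have hab : a < b := by simp [ha, hb, Fin.lt_def]
  have hmem : ∀ k, a.val ≤ k → k < b.val → k ∈ A := fun k hk hk' => by
    obtain rfl : k = i := by
      simp only [ha, hb] at hk hk'
      omega
    exact hi
  obtain ⟨v, hv, hlt⟩ := hu.exists_lt (σ := σ) h01 hA hab hmem
  have hsub := vsub_mem_vectorSpan K hv (comp_swap_mem_faceVertices hv hmem hab)
  have heq : v -ᵥ (v ∘ swap (σ a) (σ b)) = (v (σ a) - v (σ b)) • permRoot K σ i := by
    ext x
    obtain ⟨j, rfl⟩ := σ.surjective x
    simp only [vsub_eq_sub, Pi.sub_apply, Function.comp_apply, σ.injective.swap_apply,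
      Pi.smul_apply, permRoot, symm_apply_apply, smul_eq_mul]
    by_cases hja : j = a
    · subst hja
      simp [ha]
    by_cases hjb : j = b
    · subst hjb
      simp [hb]
    rw [swap_apply_of_ne_of_ne hja hjb, if_neg fun h => hja (Fin.ext h),
      if_neg fun h => hjb (Fin.ext h)]
    simp
  rw [heq] at hsub
  exact (Submodule.smul_mem_iff _ (sub_ne_zero.2 hlt.ne)).1 hsub

variable [IsStrictOrderedRing K]

/-- At a break the prefix carries the smallest entries, so all points of `faceVertices` minimize the
prefix sum over the orbit. -/
theorem prefixSum_eq_of_mem_faceVertices {u v w : Fin N → K} {σ : Perm (Fin N)} {A : Finset ℕ}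
    (hv : v ∈ faceVertices u σ A) (hw : w ∈ faceVertices u σ A) {k : ℕ} (hk : k ∉ A) :
    prefixSum K σ k v = prefixSum K σ k w := by
  set c : Fin N → K := fun x => if (σ.symm x).val ≤ k then -1 else 0 with hc
  have hmax : ∀ v ∈ faceVertices u σ A, v ∈ orbitMaximizers u c := by
    refine fun v hv => ⟨hv.1, fun x y hxy => ?_⟩
    have hx : (σ.symm x).val ≤ k := by
      by_contra h
      simp only [hc, if_neg h] at hxy
      split_ifs at hxy <;> linarith
    have hy : k < (σ.symm y).val := by
      by_contra! h
      simp [hc, hx, h] at hxy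
    simpa using hv.2 k hk _ _ hx hy
  have hsum : ∀ v : Fin N → K, ∑ x, v x * c x = -prefixSum K σ k v := by
    intro v
    rw [← Equiv.sum_comp σ, prefixSum_apply, sum_filter, ← sum_neg_distrib]
    refine sum_congr rfl fun j _ => ?_
    simp only [hc, symm_apply_apply]
    split_ifs <;> simp
  have h1 := sum_mul_le_of_mem_orbitMaximizers (hmax v hv) hw.1
  have h2 := sum_mul_le_of_mem_orbitMaximizers (hmax w hw) hv.1
  rw [hsum, hsum] at h1 h2
  linarith

theorem vectorSpan_faceVertices_le (u : Fin N → K) (σ : Perm (Fin N)) {A : Finset ℕ}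
    (hA : ∀ i ∈ A, i + 1 < N) :
    vectorSpan K (faceVertices u σ A) ≤
      Submodule.span K (Set.range fun i : A => permRoot K σ i) := by
  rw [vectorSpan_def, Submodule.span_le]
  rintro _ ⟨v, hv, w, hw, rfl⟩
  have : v -ᵥ w = ∑ i : A, prefixSum K σ i (v - w) • permRoot K σ i := by
    refine eq_of_prefixSum_eq (σ := σ) fun k => ?_
    rw [map_sum]
    simp only [map_smul, smul_eq_mul, vsub_eq_sub]
    rw [sum_coe_sort A fun i => prefixSum K σ i (v - w) * prefixSum K σ k (permRoot K σ i),
      sum_congr rfl fun i hi => by rw [prefixSum_permRoot σ (hA i hi)]]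
    simp only [mul_ite, mul_one, mul_zero, sum_ite_eq']
    split_ifs with hk
    · rfl
    · rw [map_sub, prefixSum_eq_of_mem_faceVertices hv hw hk, sub_self]
  change v -ᵥ w ∈ _
  rw [this]
  exact Submodule.sum_mem _ fun i _ => Submodule.smul_mem _ _ (Submodule.subset_span ⟨i, rfl⟩)

theorem IsDoubledMin.affDim_faceVertices {m : ℕ} {u : Fin (m + 2) → K}
    (hu : IsDoubledMin u) (σ : Perm (Fin (m + 2))) {A : Finset ℕ} (hA : ∀ i ∈ A, i + 1 < m + 2)
    (h01 : 0 ∈ A → 1 ∈ A) : affDim K (convexHull K (faceVertices u σ A)) = A.card := by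
  have hspan : vectorSpan K (faceVertices u σ A) =
      Submodule.span K (Set.range fun i : A => permRoot K σ i) := by
    refine le_antisymm (vectorSpan_faceVertices_le u σ hA) (Submodule.span_le.2 ?_)
    rintro _ ⟨i, rfl⟩
    exact hu.permRoot_mem_vectorSpan σ hA h01 i.2
  rw [affDim_convexHull, affDim, hspan, finrank_span_eq_card (linearIndependent_permRoot σ hA)]
  simp

end Dimension

/-! ### Counting the faces -/

section Counting

open Finset Equiv

variable {K : Type*} [Field K] [LinearOrder K] [IsStrictOrderedRing K] {m : ℕ}
  {u : Fin (m + 2) → K}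

theorem IsDoubledMin.affDim_of_mem_faceIndices (hu : IsDoubledMin u)
    {p : (_ : Perm (Fin (m + 2))) × Finset ℕ} (hp : p ∈ faceIndices m)
    (ρ : Perm (Fin (m + 2))) : affDim K (convexHull K (faceVertices u ρ p.2)) = p.2.card := by
  obtain ⟨σ, A⟩ := p
  rw [mem_faceIndices] at hp
  exact hu.affDim_faceVertices ρ (fun i hi => add_one_lt_of_mem_ascents (hp.1 hi)) (by tauto)

theorem IsDoubledMin.isFace_iff (hu : IsDoubledMin u) (F : Set (Fin (m + 2) → K)) :
    IsFace K (convexHull K (permOrbit u)) F ↔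
      ∃ p ∈ faceIndices m, F = convexHull K (faceVertices u p.1 p.2) := by
  constructor
  · intro h
    obtain ⟨c, rfl⟩ := (isFace_convexHull_permOrbit_iff u F).1 h
    obtain ⟨p, hp, h⟩ := hu.exists_mem_faceIndices c
    exact ⟨p, hp, by rw [h]⟩
  · rintro ⟨p, -, rfl⟩
    exact isFace_convexHull_faceVertices u p.1 p.2

theorem IsDoubledMin.convexHull_faceVertices_injOn (hu : IsDoubledMin u) :
    Set.InjOn (fun p : (_ : Perm (Fin (m + 2))) × Finset ℕ =>
      convexHull K (faceVertices u p.1 p.2)) (faceIndices m) :=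
  fun _ hp _ hq h => hu.faceVertices_injOn hp hq (convexHull_faceVertices_inj.1 h)

theorem IsDoubledMin.faceNumber_eq (hu : IsDoubledMin u) (i : ℕ) :
    faceNumber K (convexHull K (permOrbit u)) i =
      ((faceIndices m).filter fun p => p.2.card = i).card := by
  have hset : {F | IsFace K (convexHull K (permOrbit u)) F ∧ affDim K F = i} =
      (fun p : (_ : Perm (Fin (m + 2))) × Finset ℕ => convexHull K (faceVertices u p.1 p.2)) ''
        ((faceIndices m).filter fun p => p.2.card = i) := by
    ext F
    simp only [Set.mem_ofPred_eq, hu.isFace_iff, Set.mem_image, coe_filter]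
    constructor
    · rintro ⟨⟨p, hp, rfl⟩, hi⟩
      exact ⟨p, ⟨hp, by rwa [hu.affDim_of_mem_faceIndices hp p.1] at hi⟩, rfl⟩
    · rintro ⟨p, ⟨hp, hi⟩, rfl⟩
      exact ⟨⟨p, hp, rfl⟩, by rwa [hu.affDim_of_mem_faceIndices hp p.1]⟩
  rw [faceNumber, hset, Set.InjOn.ncard_image, Set.ncard_coe_finset]
  exact hu.convexHull_faceVertices_injOn.mono fun p hp => (mem_filter.1 hp).1

theorem IsDoubledMin.hPolynomial_eq (hu : IsDoubledMin u) :
    hPolynomial K (convexHull K (permOrbit u)) =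
      ∑ p ∈ faceIndices m, (X - 1 : ℤ[X]) ^ p.2.card := by
  have hmaps : ∀ p ∈ faceIndices m,
      p.2.card ∈ range (affDim K (convexHull K (permOrbit u)) + 1) := by
    intro p hp
    rw [mem_range, Nat.lt_succ_iff, ← hu.affDim_of_mem_faceIndices hp p.1]
    exact Submodule.finrank_mono (vectorSpan_mono K (convexHull_mono fun v hv => hv.1))
  rw [hPolynomial, ← sum_fiberwise_of_maps_to hmaps]
  refine sum_congr rfl fun i _ => ?_
  rw [hu.faceNumber_eq, ← nsmul_eq_mul, ← sum_const]
  exact sum_congr rfl fun p hp => by rw [(mem_filter.1 hp).2]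

end Counting

/-! ### Edges at a vertex -/

section Simple

open Finset Equiv

variable {K : Type*} [LinearOrder K] {m : ℕ} {u : Fin (m + 2) → K}

/-- By this symmetry, distinctness of the edges at any vertex reduces to the vertex `u`. -/
theorem faceVertices_mul {N : ℕ} (u : Fin N → K) (σ τ : Perm (Fin N)) (A : Finset ℕ) :
    faceVertices u (σ * τ) A = (fun v => v ∘ σ) ⁻¹' faceVertices u τ A := by
  ext v
  refine and_congr_left fun _ => ⟨fun h => comp_mem_permOrbit h σ, fun h => ?_⟩
  have := comp_mem_permOrbit h σ.symm
  rwa [Function.comp_assoc, self_comp_symm, Function.comp_id] at this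

/-- The indices of the edges at the vertex `u`. -/
def edgeIndex (m i : ℕ) : (_ : Perm (Fin (m + 2))) × Finset ℕ :=
  if i = 0 then ⟨swap 0 1, {1}⟩ else ⟨1, {i}⟩

theorem edgeIndex_mem_faceIndices {i : ℕ} (hm : 0 < m) (hi : i < m + 1) :
    edgeIndex m i ∈ faceIndices m := by
  rw [edgeIndex]
  split_ifs with h0
  · refine mem_faceIndices.2 ⟨singleton_subset_iff.2 (mem_ascents.2 ⟨by omega, ?_⟩),
      Or.inl (mem_singleton_self 1)⟩
    have h1 : (⟨1, by omega⟩ : Fin (m + 2)) = 1 := rfl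
    rw [h1, swap_apply_right, swap_apply_of_ne_of_ne (by simp [Fin.ext_iff])
      (by simp [Fin.ext_iff])]
    simp [Fin.lt_def]
  · exact mem_faceIndices.2 ⟨singleton_subset_iff.2 (mem_ascents.2 ⟨by omega, by simp⟩),
      Or.inr ⟨mem_ascents.2 ⟨by omega, by simp⟩, by simpa using Ne.symm h0⟩⟩

theorem card_edgeIndex (i : ℕ) : (edgeIndex m i).2.card = 1 := by
  rw [edgeIndex]
  split_ifs <;> simp

theorem edgeIndex_injective (m : ℕ) : Function.Injective (edgeIndex m) := by
  have hne : swap (0 : Fin (m + 2)) 1 ≠ 1 := by simp [swap_eq_one_iff]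
  intro i j h
  rw [edgeIndex, edgeIndex] at h
  split_ifs at h with hi hj hj
  · rw [hi, hj]
  · exact absurd (congrArg Sigma.fst h) hne
  · exact absurd (congrArg Sigma.fst h).symm hne
  · simpa using h

theorem IsDoubledMin.comp_swap (hu : IsDoubledMin u) : u ∘ swap 0 1 = u := by
  have h01 : u 0 = u 1 := by
    refine le_antisymm (hu.monotone (by simp)) ?_
    by_contra! h
    simpa using ((hu _ _).1 h).2
  ext i
  rw [Function.comp_apply, swap_apply_def]
  split_ifs with h0 h1
  · rw [h0, h01]
  · rw [h1, h01]
  · rfl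

theorem IsDoubledMin.comp_symm_mem_edge (hu : IsDoubledMin u) (σ : Perm (Fin (m + 2))) (i : ℕ) :
    u ∘ σ.symm ∈ faceVertices u (σ * (edgeIndex m i).1) (edgeIndex m i).2 := by
  rw [faceVertices_mul, Set.mem_preimage, Function.comp_assoc, symm_comp_self, Function.comp_id,
    edgeIndex]
  split_ifs
  · simpa [hu.comp_swap] using hu.comp_symm_mem_faceVertices (swap 0 1) {1}
  · exact hu.comp_symm_mem_faceVertices 1 {i}

/-- The functionals maximal at `u` form two chambers, exchanged by the stabilizer `swap 0 1` of `u`.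
-/
theorem IsDoubledMin.exists_monotone (hu : IsDoubledMin u) {c : Fin (m + 2) → K}
    (hc : Monovary u c) : Monotone c ∨ Monotone (c ∘ swap 0 1) := by
  have hlt : ∀ i j : Fin (m + 2), i < j → 1 < j.val → c i ≤ c j := fun i j hij hj =>
    hc.symm ((hu i j).2 ⟨hij, hj⟩)
  have h01 : ∀ i j : Fin (m + 2), i < j → ¬ 1 < j.val → i = 0 ∧ j = 1 := by
    intro i j hij hj
    rw [Fin.lt_def] at hij
    exact ⟨Fin.ext (by rw [Fin.val_zero]; omega), Fin.ext (by rw [Fin.val_one]; omega)⟩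
  rcases le_total (c 0) (c 1) with h | h
  · refine Or.inl (monotone_iff_forall_lt.2 fun i j hij => ?_)
    by_cases hj : 1 < j.val
    · exact hlt i j hij hj
    · obtain ⟨rfl, rfl⟩ := h01 i j hij hj
      exact h
  · refine Or.inr (monotone_iff_forall_lt.2 fun i j hij => ?_)
    by_cases hj : 1 < j.val
    · have hj' := lt_val_swap_zero_one zero_lt_one hj
      refine hlt _ _ ?_ hj'
      have hjs : swap 0 1 j = j := by
        apply swap_apply_of_ne_of_ne
        · rintro rfl; simp at hj
        · rintro rfl; simp at hj
      rw [hjs]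
      by_cases hi : i.val ≤ 1
      · exact Fin.lt_def.2 ((val_swap_zero_one_le zero_lt_one hi).trans_lt hj)
      · rwa [swap_apply_of_ne_of_ne]
        · rintro rfl; simp at hi
        · rintro rfl; simp at hi
    · obtain ⟨rfl, rfl⟩ := h01 i j hij hj
      simpa using h

theorem IsDoubledMin.exists_reduced (hu : IsDoubledMin u) {c : Fin (m + 2) → K}
    {σ : Perm (Fin (m + 2))} (hc : Monotone (c ∘ σ)) :
    ∃ A : Finset ℕ, (∀ i ∈ A, i + 1 < m + 2) ∧ (0 ∈ A → 1 ∈ A) ∧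
      orbitMaximizers u c = faceVertices u σ A := by
  obtain ⟨A, hA, hcA⟩ := exists_orbitMaximizers_eq_faceVertices u hc
  have hA' : ∀ i ∈ A, i + 1 < m + 2 := fun i hi => ((hA i).1 hi).1
  by_cases h1 : 1 ∈ A
  · exact ⟨A, hA', fun _ => h1, hcA⟩
  · exact ⟨A.erase 0, fun i hi => hA' i (mem_of_mem_erase hi),
      fun h => absurd h (notMem_erase 0 A), by rw [hcA, hu.faceVertices_erase_zero h1]⟩

theorem faceVertices_range (u : Fin (m + 2) → K) (σ : Perm (Fin (m + 2))) :
    faceVertices u σ (range (m + 1)) = permOrbit u := by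
  refine Set.Subset.antisymm (fun v hv => hv.1) fun v hv => ⟨hv, fun i hi j k _ hk => ?_⟩
  rw [mem_range] at hi
  omega

variable [Field K] [IsStrictOrderedRing K]

/-- An edge has a singleton `A = {i}` with `i ≥ 1`, in one of the two chambers. The chambers give
different edges for `i = 1` and the same edge for `i ≥ 2`, so there are `m + 1` indices. -/
theorem IsDoubledMin.exists_edgeIndex (hu : IsDoubledMin u) {σ : Perm (Fin (m + 2))}
    {c : Fin (m + 2) → K} (hdim : affDim K (convexHull K (orbitMaximizers u c)) = 1)
    (hmem : u ∘ σ.symm ∈ orbitMaximizers u c) :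
    ∃ i < m + 1, orbitMaximizers u c =
      faceVertices u (σ * (edgeIndex m i).1) (edgeIndex m i).2 := by
  have hcσ : Monovary u (c ∘ σ) := fun i j hij => by simpa using hmem.2 hij
  have hsingle : ∀ τ : Perm (Fin (m + 2)), Monotone (c ∘ τ) → ∃ i, 0 < i ∧ i < m + 1 ∧
      orbitMaximizers u c = faceVertices u τ {i} := by
    intro τ hτ
    obtain ⟨A, hA, h01, hcA⟩ := hu.exists_reduced hτ
    rw [hcA, hu.affDim_faceVertices τ hA h01] at hdim
    obtain ⟨i, rfl⟩ := card_eq_one.1 hdim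
    refine ⟨i, Nat.pos_of_ne_zero ?_, by simpa using hA i (mem_singleton_self i), hcA⟩
    rintro rfl
    simp at h01
  rcases hu.exists_monotone hcσ with h | h
  · obtain ⟨i, hi0, hi, heq⟩ := hsingle σ h
    refine ⟨i, hi, ?_⟩
    rw [edgeIndex, if_neg hi0.ne', mul_one, heq]
  · obtain ⟨i, hi0, hi, heq⟩ := hsingle (σ * swap 0 1) (by
      rwa [Perm.coe_mul, ← Function.comp_assoc])
    by_cases hi1 : i = 1
    · subst hi1
      exact ⟨0, by omega, by rw [edgeIndex, if_pos rfl, heq]⟩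
    · refine ⟨i, hi, ?_⟩
      rw [edgeIndex, if_neg hi0.ne', mul_one, heq, hu.faceVertices_mul_swap
        (by simpa using hi0.ne) (by simpa using Ne.symm hi1)]

theorem IsDoubledMin.affDim_permOrbit (hu : IsDoubledMin u) (hm : 0 < m) :
    affDim K (convexHull K (permOrbit u)) = m + 1 := by
  rw [← faceVertices_range u 1, hu.affDim_faceVertices 1 (fun i hi => by simpa using hi)
    (fun _ => by simpa using hm), card_range]

theorem IsDoubledMin.affDim_permOrbit_zero {u : Fin (0 + 2) → K} (hu : IsDoubledMin u) :
    affDim K (convexHull K (permOrbit u)) = 0 := by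
  rw [← faceVertices_range u 1, ← hu.faceVertices_erase_zero (by simp),
    hu.affDim_faceVertices 1 (by simp) (by simp)]
  simp

theorem IsDoubledMin.encard_edges (hu : IsDoubledMin u) (σ : Perm (Fin (m + 2))) :
    {F | IsFace K (convexHull K (permOrbit u)) F ∧ affDim K F = 1 ∧ u ∘ σ.symm ∈ F}.encard =
      (affDim K (convexHull K (permOrbit u)) : ℕ∞) := by
  -- For `m = 0` the polytope is a point and has no edges; position 1, used by `edgeIndex`, then
  -- does not exist.
  rcases Nat.eq_zero_or_pos m with rfl | hm
  · rw [hu.affDim_permOrbit_zero, Nat.cast_zero, Set.encard_eq_zero,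
      Set.eq_empty_iff_forall_notMem]
    rintro F ⟨⟨-, l, rfl⟩, hdim, -⟩
    have hle : affDim K {x | x ∈ convexHull K (permOrbit u) ∧
        ∀ y ∈ convexHull K (permOrbit u), l y ≤ l x} ≤ affDim K (convexHull K (permOrbit u)) :=
      Submodule.finrank_mono (vectorSpan_mono K fun x hx => hx.1)
    rw [hdim, hu.affDim_permOrbit_zero] at hle
    omega
  · have hset : {F | IsFace K (convexHull K (permOrbit u)) F ∧ affDim K F = 1 ∧
        u ∘ σ.symm ∈ F} = (fun i => convexHull K
          (faceVertices u (σ * (edgeIndex m i).1) (edgeIndex m i).2)) '' (range (m + 1)) := by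
      ext F
      constructor
      · rintro ⟨hF, hdim, hmem⟩
        obtain ⟨c, rfl⟩ := (isFace_convexHull_permOrbit_iff u F).1 hF
        have hmem' : u ∘ σ.symm ∈ orbitMaximizers u c := by
          rw [← permOrbit_inter_convexHull_orbitMaximizers]
          exact ⟨⟨σ.symm, rfl⟩, hmem⟩
        obtain ⟨i, hi, heq⟩ := hu.exists_edgeIndex hdim hmem'
        exact ⟨i, by simpa using hi, by simp only [heq]⟩
      · rintro ⟨i, hi, rfl⟩
        have hp := edgeIndex_mem_faceIndices hm (by simpa using hi)
        refine ⟨isFace_convexHull_faceVertices _ _ _, ?_,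
          subset_convexHull K _ (hu.comp_symm_mem_edge σ i)⟩
        exact (hu.affDim_of_mem_faceIndices hp _).trans (card_edgeIndex i)
    have hinj : Set.InjOn (fun i => convexHull K
        (faceVertices u (σ * (edgeIndex m i).1) (edgeIndex m i).2)) (range (m + 1)) := by
      intro i hi j hj h
      have h := convexHull_faceVertices_inj.1 h
      rw [faceVertices_mul, faceVertices_mul] at h
      have hsurj : Function.Surjective fun v : Fin (m + 2) → K => v ∘ σ := fun v =>
        ⟨v ∘ σ.symm, by simp [Function.comp_assoc]⟩
      exact edgeIndex_injective m (hu.faceVertices_injOn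
        (edgeIndex_mem_faceIndices hm (by simpa using hi))
        (edgeIndex_mem_faceIndices hm (by simpa using hj)) (hsurj.preimage_injective h))
    rw [hset, hinj.encard_image, Set.encard_coe_eq_coe_finsetCard, card_range,
      hu.affDim_permOrbit hm]

theorem IsDoubledMin.isSimplePolytope (hu : IsDoubledMin u) :
    IsSimplePolytope K (convexHull K (permOrbit u)) := by
  refine ⟨⟨_, permOrbit_finite u, rfl⟩, fun v hv => ?_⟩
  obtain ⟨c, hc⟩ := (isFace_convexHull_permOrbit_iff u _).1 hv
  obtain ⟨y, hy⟩ := orbitMaximizers_nonempty u c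
  obtain rfl : y = v := by
    rw [← Set.mem_singleton_iff, hc]
    exact subset_convexHull K _ hy
  obtain ⟨ρ, rfl⟩ := hy.1
  exact hu.encard_edges ρ.symm

end Simple

/-! ### Dominant weights fixed only by the last simple reflection -/

section Weights

theorem simpleReflection_injective (n : ℕ) : Function.Injective (simpleReflection n) := by
  intro i j h
  have := congrArg (fun s : Equiv.Perm (Fin (n + 1)) => s i.castSucc) h
  simp only [simpleReflection, Equiv.swap_apply_left, Equiv.swap_apply_def] at this
  split_ifs at this with h1 h2
  · exact Fin.castSucc_injective n h1
  · simp only [Fin.ext_iff, Fin.val_succ, Fin.val_castSucc] at this h2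
    omega
  · simp [Fin.ext_iff] at this

variable {K : Type*}

theorem weylAct_simpleReflection_eq_iff {n : ℕ} (w : Fin (n + 1) → K) (i : Fin n) :
    weylAct (simpleReflection n i) w = w ↔ w i.castSucc = w i.succ := by
  constructor
  · intro h
    have := congrFun h i.succ
    simpa [weylAct, simpleReflection] using this
  · intro h
    ext k
    simp only [weylAct, simpleReflection, Equiv.symm_swap, Equiv.swap_apply_def]
    split_ifs with h1 h2
    · rw [h1, h]
    · rw [h2, h]
    · rfl

variable [Field K] [LinearOrder K]

theorem isDominantOfType_last_iff {m : ℕ} (w : Fin (m + 2) → K) :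
    IsDominantOfType {simpleReflection (m + 1) (Fin.last m)} w ↔
      ∑ k, w k = 0 ∧ (∀ i : Fin (m + 1), w i.succ ≤ w i.castSucc) ∧
        ∀ i : Fin (m + 1), w i.castSucc = w i.succ ↔ i = Fin.last m := by
  refine and_congr_right fun _ => and_congr_right fun _ => ?_
  rw [Set.ext_iff]
  constructor
  · intro h i
    rw [← weylAct_simpleReflection_eq_iff, ← (simpleReflection_injective (m + 1)).eq_iff]
    have := h (simpleReflection (m + 1) i)
    simp only [Set.mem_singleton_iff, Set.mem_ofPred_eq, Set.mem_range_self, true_and] at this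
    exact this.symm
  · intro h s
    simp only [Set.mem_singleton_iff, Set.mem_ofPred_eq]
    constructor
    · rintro rfl
      exact ⟨⟨_, rfl⟩, (weylAct_simpleReflection_eq_iff w _).2 ((h _).2 rfl)⟩
    · rintro ⟨⟨i, rfl⟩, hi⟩
      rw [(h i).1 ((weylAct_simpleReflection_eq_iff w i).1 hi)]

theorem isDoubledMin_comp_rev {m : ℕ} {w : Fin (m + 2) → K}
    (hw : IsDominantOfType {simpleReflection (m + 1) (Fin.last m)} w) :
    IsDoubledMin (w ∘ Fin.rev) := by
  obtain ⟨-, hle, heq⟩ := (isDominantOfType_last_iff w).1 hw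
  have hanti : Antitone w := Fin.antitone_iff_succ_le.2 hle
  intro i j
  simp only [Function.comp_apply]
  constructor
  · intro h
    have hij : i < j := by
      by_contra! hji
      exact absurd h (not_lt.2 (hanti (Fin.rev_le_rev.2 hji)))
    refine ⟨hij, ?_⟩
    by_contra hj
    rw [Fin.lt_def] at hij
    have hi' : i.rev = (Fin.last m).succ := Fin.ext (by simp; omega)
    have hj' : j.rev = (Fin.last m).castSucc := Fin.ext (by simp; omega)
    rw [hi', hj', (heq _).2 rfl] at h
    exact lt_irrefl _ h
  · rintro ⟨hij, hj⟩
    rw [Fin.lt_def] at hij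
    -- The strict drop of `w` is found just after the coordinate `j.rev`; `1 < j` keeps this step
    -- away from the last one, where `w` is constant.
    set k : Fin (m + 1) := ⟨m + 1 - j.val, by omega⟩ with hk
    have hkj : j.rev = k.castSucc := Fin.ext (by simp [hk])
    have hki : k.succ ≤ i.rev := by
      rw [Fin.le_def]
      simp [hk]
      omega
    have hkl : k ≠ Fin.last m := by
      rw [Ne, Fin.ext_iff]
      simp [hk]
      omega
    rw [hkj]
    exact (hanti hki).trans_lt (lt_of_le_of_ne (hle k) fun h => hkl ((heq k).1 h.symm))

theorem exists_isDominantOfType_last [IsStrictOrderedRing K] (m : ℕ) :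
    ∃ w : Fin (m + 2) → K, IsDominantOfType {simpleReflection (m + 1) (Fin.last m)} w := by
  -- The vector `-min k m` decreases strictly except at its last step; subtracting its mean makes
  -- the sum zero.
  refine ⟨fun k => (∑ i : Fin (m + 2), ((min i.val m : ℕ) : K)) / (m + 2) -
    ((min k.val m : ℕ) : K), (isDominantOfType_last_iff _).2 ⟨?_, ?_, ?_⟩⟩
  · have : (m + 2 : K) ≠ 0 := by positivity
    rw [Finset.sum_sub_distrib, Finset.sum_const, Finset.card_univ, Fintype.card_fin, nsmul_eq_mul]
    push_cast
    field_simp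
    ring
  · intro i
    rw [sub_le_sub_iff_left, Nat.cast_le, Fin.val_succ, Fin.val_castSucc]
    omega
  · intro i
    rw [sub_right_inj, Nat.cast_inj, Fin.val_succ, Fin.val_castSucc, Fin.ext_iff, Fin.val_last]
    omega

end Weights

theorem theorem5 (K : Type*) [Field K] [LinearOrder K] [IsStrictOrderedRing K]
    (n : ℕ) (hn : 1 ≤ n) (J : Set (Equiv.Perm (Fin (n + 1))))
    (hJ : J = {simpleReflection n ⟨n - 1, Nat.sub_lt hn Nat.one_pos⟩}) :
    CombinatoriallySmooth K J ∧
      ∀ w : Fin (n + 1) → K, IsDominantOfType J w →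
        hPolynomial K (weightPolytope w) =
          eulerianPolynomial (n + 1) -
            ((n + 1).choose 2 : ℤ[X]) * X * eulerianPolynomial (n - 1) := by
  obtain ⟨m, rfl⟩ : ∃ m, n = m + 1 := ⟨n - 1, by omega⟩
  subst hJ
  refine ⟨⟨exists_isDominantOfType_last m, fun w hw => ?_⟩, fun w hw => ?_⟩
  · rw [weightPolytope_eq_convexHull_permOrbit]
    exact (isDoubledMin_comp_rev hw).isSimplePolytope
  · rw [weightPolytope_eq_convexHull_permOrbit, (isDoubledMin_comp_rev hw).hPolynomial_eq]
    exact sum_faceIndices m
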